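/- Let $(S,\Sigma,P)$ be a probability space that is adequate, i.e. either (a) $P$ is nonatomic: every $A\in\Sigma$ with $P(A)>0$ contains some $B\in\Sigma$ with $0<P(B)<P(A)$; or (b) $\Sigma$ is generated by a finite partition of $S$ all of whose cells have the same probability. Let $\mathcal F$ be either $\mathcal L^\infty$, the space of all almost surely bounded measurable functions $f:S\to\mathbb R$, or $\mathcal M^\infty=\bigcap_{p\in\mathbb N}\mathcal L^p$, the space of all measurable functions $f:S\to\mathbb R$ with finite absolute moments of all orders. Write $f\overset{d}{=}g$ if $P\circ f^{-1}=P\circ g^{-1}$, and identify real numbers with constant functions. Let $\succsim$ be a risk preference on $\mathcal F$, that is, a transitive binary relation on $\mathcal F$ that is law invariant: for all $f,g\in\mathcal F$, if $f\overset{d}{=}g$, then $f\succsim g$ and $g\succsim f$. Then the following are equivalent: (i) (weak, or Arrow–Pratt, risk aversion) $\mathbb E[f]\succsim f$ for all $f\in\mathcal F$; (ii) (propensity to full insurance) for all $w,f,g\in\mathcal F$ with $g\overset{d}{=}f$, if $f=-w-\pi$ for some $\pi\in\mathbb R$, then $w+f\succsim w+g$. -/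

import Mathlib

open MeasureTheory
open scoped ENNReal

namespace RiskPref

/-- Nonatomic measure: every event of positive measure contains an event of strictly smaller
positive measure. -/
def IsNonatomic {S : Type*} [MeasurableSpace S] (P : Measure S) : Prop :=
  ∀ A : Set S, MeasurableSet A → 0 < P A →
    ∃ B : Set S, B ⊆ A ∧ MeasurableSet B ∧ 0 < P B ∧ P B < P A

/-- The sigma-algebra is generated by a finite partition of the state space, all of whose cells
have the same probability. -/
def IsUniformOnFinitePartition {S : Type*} [m : MeasurableSpace S] (P : Measure S) : Prop :=
  ∃ C : Set (Set S), C.Finite ∧ Setoid.IsPartition C ∧ m = MeasurableSpace.generateFrom C ∧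
    ∀ A ∈ C, P A = (C.ncard : ℝ≥0∞)⁻¹

/-- Adequate probability measure. -/
def IsAdequate {S : Type*} [MeasurableSpace S] (P : Measure S) : Prop :=
  IsNonatomic P ∨ IsUniformOnFinitePartition P

/-- The space of all measurable real functions that are almost surely bounded. -/
def boundedPayoffs {S : Type*} [MeasurableSpace S] (P : Measure S) : Submodule ℝ (S → ℝ) where
  carrier := {f | Measurable f ∧ MemLp f ∞ P}
  add_mem' := fun hf hg => ⟨hf.1.add hg.1, hf.2.add hg.2⟩
  zero_mem' := ⟨measurable_const, MemLp.zero⟩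
  smul_mem' := fun c _ hf => ⟨hf.1.const_smul c, hf.2.const_smul c⟩

/-- The space of all measurable real functions with finite absolute moments of all orders. -/
def finiteMomentPayoffs {S : Type*} [MeasurableSpace S] (P : Measure S) :
    Submodule ℝ (S → ℝ) where
  carrier := {f | Measurable f ∧ ∀ p : ℕ, MemLp f p P}
  add_mem' := fun hf hg => ⟨hf.1.add hg.1, fun p => (hf.2 p).add (hg.2 p)⟩
  zero_mem' := ⟨measurable_const, fun _ => MemLp.zero⟩
  smul_mem' := fun c _ hf => ⟨hf.1.const_smul c, fun p => (hf.2 p).const_smul c⟩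

/-- The two admissible choices for the space of random payoffs. -/
inductive PayoffClass
  | bounded
  | finiteMoments

/-- The space of random payoffs. Its elements are functions, not classes of almost surely equal
functions. -/
def Payoffs {S : Type*} [MeasurableSpace S] (P : Measure S) : PayoffClass → Submodule ℝ (S → ℝ)
  | .bounded => boundedPayoffs P
  | .finiteMoments => finiteMomentPayoffs P

theorem const_mem_payoffs {S : Type*} [MeasurableSpace S] (P : Measure S) [IsFiniteMeasure P]
    (k : PayoffClass) (a : ℝ) : (fun _ : S => a) ∈ Payoffs P k := by
  cases k with
  | bounded => exact ⟨measurable_const, memLp_const a⟩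
  | finiteMoments => exact ⟨measurable_const, fun _ => memLp_const a⟩

/-- The sure payoff `a`. -/
def sure {S : Type*} [MeasurableSpace S] (P : Measure S) [IsFiniteMeasure P]
    (k : PayoffClass) (a : ℝ) : Payoffs P k :=
  ⟨fun _ => a, const_mem_payoffs P k a⟩

/-- The expectation of a random payoff. -/
noncomputable def expectation {S : Type*} [MeasurableSpace S] {P : Measure S} {k : PayoffClass}
    (f : Payoffs P k) : ℝ :=
  ∫ s, (f : S → ℝ) s ∂P

/-- Two random payoffs are equally distributed when they induce the same law on the line. -/
def EqDist {S : Type*} [MeasurableSpace S] {P : Measure S} {k : PayoffClass}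
    (f g : Payoffs P k) : Prop :=
  P.map (f : S → ℝ) = P.map (g : S → ℝ)

/-- A risk preference is a transitive and law-invariant binary relation on the space of random
payoffs; `R f g` reads "`f` is (weakly) preferred to `g`". -/
structure IsRiskPreference {S : Type*} [MeasurableSpace S] {P : Measure S} {k : PayoffClass}
    (R : Payoffs P k → Payoffs P k → Prop) : Prop where
  trans : ∀ f g h : Payoffs P k, R f g → R g h → R f h
  law_invariant : ∀ f g : Payoffs P k, EqDist f g → R f g ∧ R g f

/-- Weak (Arrow-Pratt) risk aversion: the sure payoff `E[f]` is preferred to `f`. -/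
def WeaklyRiskAverse {S : Type*} [MeasurableSpace S] {P : Measure S} [IsFiniteMeasure P]
    {k : PayoffClass} (R : Payoffs P k → Payoffs P k → Prop) : Prop :=
  ∀ f : Payoffs P k, R (sure P k (expectation f)) f

/-- `f` is a full insurance for `w` when `f = -w - π` for some premium `π`. -/
def IsFullInsurance {S : Type*} [MeasurableSpace S] {P : Measure S} [IsFiniteMeasure P]
    {k : PayoffClass} (w f : Payoffs P k) : Prop :=
  ∃ π : ℝ, f = -w - sure P k π

/-- Propensity to full insurance. -/
def PropenseToFullInsurance {S : Type*} [MeasurableSpace S] {P : Measure S} [IsFiniteMeasure P]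
    {k : PayoffClass} (R : Payoffs P k → Payoffs P k → Prop) : Prop :=
  ∀ w f g : Payoffs P k, EqDist g f → IsFullInsurance w f → R (w + f) (w + g)

end RiskPref

namespace RiskPref

/-! Full insurance leaves the sure amount `-π`, and replacing `f` by an equally distributed `g` does
not change the mean, so `-π = E[w + g]`: weak risk aversion gives the preference at once.
Conversely, let `g` and `l` be equally distributed and `m` real. Insuring `l` fully by `-l + m`,
against the alternative `-g + m`, yields that `m` is preferred to `m + l - g`. By law invariance and
transitivity it is enough that `f - E[f]` have the law of such a difference `l - g` within the
payoff space (`IsDifferenceInLaw`). On a uniform finite space, a zero-sum function is a coboundary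
of the cyclic rotation of the cells. On a nonatomic space, a nonzero centred law is a mixture of
centred laws on pairs `y ≤ 0 < z`. Each of these is the law of the increment of a rotation of `[0, z
- y)`, which preserves Lebesgue measure (`map_rotation_rotationLaw`,
`map_rotationStep_rotationLaw`). The mixture is then realised on `S` through a uniform variable
(`IsNonatomic.exists_map_eq`). -/

/-- `f - E[f]` has the law of a difference of two identically distributed payoffs. -/
def IsDifferenceInLaw {S : Type*} [MeasurableSpace S] {P : Measure S} {k : PayoffClass}
    (f : Payoffs P k) : Prop :=
  ∃ g h : Payoffs P k, EqDist g h ∧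
    P.map ((h : S → ℝ) - (g : S → ℝ)) = P.map (fun s => (f : S → ℝ) s - expectation f)

/-! ### Reduction to differences of equally distributed payoffs. -/

section

variable {S : Type*} [MeasurableSpace S] {P : Measure S} {k : PayoffClass}

theorem measurable_payoff (f : Payoffs P k) : Measurable (f : S → ℝ) := by
  cases k with
  | bounded => exact f.2.1
  | finiteMoments => exact f.2.1

theorem payoff_mem_of_memLp_top [IsFiniteMeasure P] {f : S → ℝ} (hf : Measurable f)
    (h : MemLp f ∞ P) : f ∈ Payoffs P k := by
  cases k with
  | bounded => exact ⟨hf, h⟩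
  | finiteMoments => exact ⟨hf, fun p => h.mono_exponent le_top⟩

theorem integrable_payoff [IsFiniteMeasure P] (f : Payoffs P k) :
    Integrable (f : S → ℝ) P := by
  cases k with
  | bounded => exact f.2.2.integrable le_top
  | finiteMoments => exact memLp_one_iff_integrable.1 (by simpa using f.2.2 1)

theorem EqDist.comp {f g : Payoffs P k} (h : EqDist f g) {φ : ℝ → ℝ} (hφ : Measurable φ) :
    P.map (fun s => φ ((f : S → ℝ) s)) = P.map (fun s => φ ((g : S → ℝ) s)) := by
  have hf := Measure.map_map (μ := P) hφ (measurable_payoff f)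
  have hg := Measure.map_map (μ := P) hφ (measurable_payoff g)
  unfold EqDist at h
  rw [h, hg] at hf
  exact hf.symm

theorem WeaklyRiskAverse.propenseToFullInsurance [IsProbabilityMeasure P]
    {R : Payoffs P k → Payoffs P k → Prop} (h : WeaklyRiskAverse R) :
    PropenseToFullInsurance R := by
  rintro w f g hfg ⟨π, hπ⟩
  have hwf : w + f = sure P k (-π) := by
    rw [hπ]; ext s; simp [sure]; ring
  have hE : expectation (w + g) = -π := by
    have hg : ∫ s, (g : S → ℝ) s ∂P = ∫ s, (f : S → ℝ) s ∂P := by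
      have hg := integral_map (measurable_payoff g).aemeasurable
        (measurable_id (α := ℝ)).aestronglyMeasurable (μ := P)
      have hf := integral_map (measurable_payoff f).aemeasurable
        (measurable_id (α := ℝ)).aestronglyMeasurable (μ := P)
      have hfg' : P.map (g : S → ℝ) = P.map (f : S → ℝ) := hfg
      rw [hfg', hf] at hg
      exact hg.symm
    have hsum : expectation (w + g) = ∫ s, (w : S → ℝ) s ∂P + ∫ s, (g : S → ℝ) s ∂P :=
      integral_add (integrable_payoff w) (integrable_payoff g)
    have hsum' : expectation (w + f) = ∫ s, (w : S → ℝ) s ∂P + ∫ s, (f : S → ℝ) s ∂P :=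
      integral_add (integrable_payoff w) (integrable_payoff f)
    rw [hsum, hg, ← hsum', hwf]
    simp [expectation, sure]
  rw [hwf, ← hE]
  exact h _

theorem PropenseToFullInsurance.weaklyRiskAverse [IsProbabilityMeasure P]
    {R : Payoffs P k → Payoffs P k → Prop} (hR : IsRiskPreference R)
    (hd : ∀ f : Payoffs P k, IsDifferenceInLaw f) (h : PropenseToFullInsurance R) :
    WeaklyRiskAverse R := by
  intro f
  obtain ⟨g, l, hgl, hX⟩ := hd f
  set m := expectation f
  -- The premium is `-m`, so the insured position is exactly the mean `m`, while the alternative is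
  -- `m + l - g`, a copy in law of `f`.
  have key := h l (-l + sure P k m) (-g + sure P k m)
    (hgl.comp (φ := fun x => -x + m) (by fun_prop)) ⟨-m, by ext s; simp [sure]⟩
  have hsure : l + (-l + sure P k m) = sure P k m := by abel
  rw [hsure] at key
  refine hR.trans _ _ _ key (hR.law_invariant _ _ ?_).1
  have hl := measurable_payoff l
  have hg := measurable_payoff g
  have hf := measurable_payoff f
  have h1 := Measure.map_map (μ := P) (g := fun x : ℝ => x + m) (by fun_prop) (hl.sub hg)
  have h2 := Measure.map_map (μ := P) (g := fun x : ℝ => x + m) (by fun_prop) (hf.sub_const m)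
  rw [hX, h2] at h1
  unfold EqDist
  convert h1.symm using 2
  · ext s; simp [sure]; ring
  · ext s; simp

end

/-! ### Uniform finite spaces: cyclic coboundaries. -/

/-- A zero-sum function on a finite cyclic group of indices is a coboundary of the rotation. -/
theorem exists_cyclic_coboundary (m : ℕ) (φ : Fin (m + 1) → ℝ) (h : ∑ i, φ i = 0) :
    ∃ ψ : Fin (m + 1) → ℝ, ∀ i, ψ (finRotate (m + 1) i) - ψ i = φ i := by
  -- Partial sums. The last index rotates to `0`, where the sum is empty; the vanishing total closes
  -- the cycle.
  refine ⟨fun i => ∑ j : Fin (m + 1) with j < i, φ j, fun i => ?_⟩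
  rcases Fin.eq_castSucc_or_eq_last i with ⟨j, rfl⟩ | rfl
  · have h1 : finRotate (m + 1) j.castSucc = j.succ := by simp
    have h2 : (Finset.univ.filter fun l : Fin (m + 1) => l < j.succ) =
        insert j.castSucc (Finset.univ.filter fun l : Fin (m + 1) => l < j.castSucc) := by
      ext l
      simp only [Finset.mem_filter, Finset.mem_univ, true_and, Finset.mem_insert, Fin.lt_def,
        Fin.ext_iff, Fin.val_succ, Fin.val_castSucc]
      omega
    simp only [h1, h2]
    rw [Finset.sum_insert (by simp)]
    ring
  · have h2 : (Finset.univ : Finset (Fin (m + 1))) =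
        insert (Fin.last m) (Finset.univ.filter fun l : Fin (m + 1) => l < Fin.last m) := by
      ext l
      simp only [Finset.mem_filter, Finset.mem_univ, true_and, Finset.mem_insert, true_iff]
      exact (Fin.le_last l).eq_or_lt
    rw [h2, Finset.sum_insert (by simp)] at h
    simp only [finRotate_last]
    simp only [Fin.not_lt_zero, Finset.filter_false, Finset.sum_empty]
    linarith

theorem IsUniformOnFinitePartition.exists_index {S : Type*} [mS : MeasurableSpace S]
    (P : Measure S) [IsProbabilityMeasure P] (hP : IsUniformOnFinitePartition P) :
    ∃ (m : ℕ) (ι : S → Fin (m + 1)), Measurable ι ∧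
      (∀ i, P.map ι {i} = ((m + 1 : ℕ) : ℝ≥0∞)⁻¹) ∧
      ∀ f : S → ℝ, Measurable f → ∃ φ : Fin (m + 1) → ℝ, f = φ ∘ ι := by
  obtain ⟨C, hfin, hC, hgen, hcell⟩ := hP
  have hS : Nonempty S := nonempty_of_isProbabilityMeasure P
  choose c hc hcu using hC.2
  have hmem : ∀ s, s ∈ c s := fun s => (hc s).2
  have hcC : ∀ s, c s ∈ C := fun s => (hc s).1
  have huniq : ∀ s, ∀ A ∈ C, s ∈ A → A = c s := fun s A hA hs => hcu s A ⟨hA, hs⟩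
  have : Finite C := hfin
  have hCne : Nonempty C := ⟨⟨c hS.some, hcC _⟩⟩
  obtain ⟨m, hm⟩ : ∃ m, Nat.card C = m + 1 :=
    ⟨Nat.card C - 1, by have := Nat.card_pos (α := C); omega⟩
  have e : C ≃ Fin (m + 1) := Finite.equivFinOfCardEq hm
  let ι : S → Fin (m + 1) := fun s => e ⟨c s, hcC s⟩
  have hfib : ∀ i, ι ⁻¹' {i} = (e.symm i : Set S) := by
    intro i
    ext s
    simp only [Set.mem_preimage, Set.mem_singleton_iff, ι]
    rw [← e.eq_symm_apply, Subtype.ext_iff]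
    exact ⟨fun h => h ▸ hmem s, fun h => (huniq s _ (e.symm i).2 h).symm⟩
  have hι : Measurable ι := by
    refine measurable_to_countable' fun i => ?_
    rw [hfib, hgen]
    exact MeasurableSpace.measurableSet_generateFrom (e.symm i).2
  refine ⟨m, ι, hι, fun i => ?_, fun f hf => ?_⟩
  · rw [Measure.map_apply hι (measurableSet_singleton i), hfib, hcell _ (e.symm i).2,
      ← Nat.card_coe_set_eq, hm]
  -- Every event is a union of cells, so level sets of `f` are pulled back from indices and `f`
  -- factors through `ι`.
  · have hle : mS ≤ MeasurableSpace.comap ι ⊤ := by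
      rw [hgen]
      refine MeasurableSpace.generateFrom_le fun A hA => ?_
      refine ⟨{e ⟨A, hA⟩}, trivial, ?_⟩
      rw [hfib]; simp
    have hconst : ∀ s t, ι s = ι t → f s = f t := by
      intro s t hst
      obtain ⟨T, -, hT⟩ := hle _ (hf (measurableSet_singleton (f t)))
      have ht : t ∈ f ⁻¹' {f t} := rfl
      rw [← hT] at ht
      have hs : s ∈ ι ⁻¹' T := by
        rw [Set.mem_preimage, hst]; exact ht
      rw [hT] at hs
      exact hs
    exact ⟨Function.extend ι f 0, funext fun s =>
      (Function.FactorsThrough.extend_apply (fun s t h => hconst s t h) 0 s).symm⟩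

/-- Uniformity of the index makes its law invariant under rotation, so a coboundary potential and
its rotate are equally distributed; zero sum is the centring of `f`. -/
theorem IsUniformOnFinitePartition.isDifferenceInLaw {S : Type*} [MeasurableSpace S]
    {P : Measure S} [IsProbabilityMeasure P] (hP : IsUniformOnFinitePartition P)
    {k : PayoffClass} (f : Payoffs P k) : IsDifferenceInLaw f := by
  obtain ⟨m, ι, hι, hunif, hfac⟩ := hP.exists_index
  obtain ⟨φ, hφ⟩ := hfac f (measurable_payoff f)
  have hE : expectation f = ((m : ℝ) + 1)⁻¹ * ∑ i, φ i := by
    have h1 := integral_map (μ := P) hι.aemeasurable (f := φ)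
      (measurable_of_finite φ).aestronglyMeasurable
    have : IsProbabilityMeasure (P.map ι) := Measure.isProbabilityMeasure_map hι.aemeasurable
    rw [integral_fintype (Integrable.of_finite)] at h1
    have h2 : expectation f = ∫ s, φ (ι s) ∂P := by
      unfold expectation; rw [hφ]; rfl
    rw [h2, ← h1, Finset.mul_sum]
    refine Finset.sum_congr rfl fun i _ => ?_
    rw [measureReal_def, hunif i]
    simp [ENNReal.toReal_add]
  obtain ⟨ψ, hψ⟩ := exists_cyclic_coboundary m (fun i => φ i - expectation f) (by
    rw [Finset.sum_sub_distrib, hE]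
    simp only [Finset.sum_const, Finset.card_univ, Fintype.card_fin, nsmul_eq_mul]
    push_cast
    field_simp
    ring)
  have hmem : ∀ χ : Fin (m + 1) → ℝ, (fun s => χ (ι s)) ∈ Payoffs P k := by
    intro χ
    have hχ : Measurable fun s => χ (ι s) := (measurable_of_finite χ).comp hι
    refine payoff_mem_of_memLp_top hχ
      (memLp_top_of_bound hχ.aestronglyMeasurable (∑ i, ‖χ i‖) (ae_of_all _ fun s => ?_))
    exact Finset.single_le_sum (f := fun i => ‖χ i‖) (fun i _ => norm_nonneg _)
      (Finset.mem_univ (ι s))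
  refine ⟨⟨_, hmem ψ⟩, ⟨_, hmem (ψ ∘ finRotate (m + 1))⟩, ?_, ?_⟩
  · have hrot : P.map (fun s => finRotate (m + 1) (ι s)) = P.map ι := by
      refine Measure.ext_of_singleton fun i => ?_
      have h1 := Measure.map_map (μ := P) (measurable_of_finite (finRotate (m + 1))) hι
      have h2 : P.map (fun s => finRotate (m + 1) (ι s)) =
        (P.map ι).map (finRotate (m + 1)) := h1.symm
      have h3 : finRotate (m + 1) ⁻¹' {i} = {(finRotate (m + 1)).symm i} := by
        ext j; exact (Equiv.eq_symm_apply _).symm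
      rw [h2, Measure.map_apply (measurable_of_finite _) (measurableSet_singleton i), h3,
        hunif, hunif]
    have h1 := Measure.map_map (μ := P) (measurable_of_finite ψ) hι
    have h2 := Measure.map_map (μ := P) (measurable_of_finite ψ)
      ((measurable_of_finite (finRotate (m + 1))).comp hι)
    change P.map (ψ ∘ ι) = P.map (ψ ∘ (finRotate (m + 1) ∘ ι))
    rw [← h1, ← h2]
    exact congrArg _ hrot.symm
  · congr 1
    ext s
    rw [hφ]
    exact hψ (ι s)

/-! ### Nonatomic spaces: intermediate values and a uniform variable. -/

section

variable {S : Type*} [MeasurableSpace S] {P : Measure S}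

/-- A strictly smaller non-null `B` and its complement in `A` are both non-null, and one of them has
at most half the mass. -/
theorem IsNonatomic.exists_subset_le_half [IsFiniteMeasure P] (hP : IsNonatomic P) {A : Set S}
    (hA : MeasurableSet A) (h0 : 0 < P A) :
    ∃ B ⊆ A, MeasurableSet B ∧ 0 < P B ∧ P B ≤ P A / 2 := by
  obtain ⟨B, hBA, hB, hB0, hlt⟩ := hP A hA h0
  by_cases hle : P B ≤ P A / 2
  · exact ⟨B, hBA, hB, hB0, hle⟩
  · refine ⟨A \ B, Set.sdiff_subset, hA.diff hB, ?_, ?_⟩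
    · rw [measure_sdiff hBA hB.nullMeasurableSet (measure_ne_top P B)]
      exact tsub_pos_of_lt hlt
    · rw [measure_sdiff hBA hB.nullMeasurableSet (measure_ne_top P B)]
      have h2 : P A / 2 + P B ≥ P A := by
        calc P A = P A / 2 + P A / 2 := (ENNReal.add_halves _).symm
          _ ≤ P A / 2 + P B := by gcongr; exact (not_le.1 hle).le
      exact tsub_le_iff_right.2 h2

theorem IsNonatomic.exists_subset_lt [IsFiniteMeasure P] (hP : IsNonatomic P) {A : Set S}
    (hA : MeasurableSet A) (h0 : 0 < P A) {ε : ℝ≥0∞} (hε : 0 < ε) :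
    ∃ B ⊆ A, MeasurableSet B ∧ 0 < P B ∧ P B < ε := by
  have hn : ∀ n : ℕ, ∃ B ⊆ A, MeasurableSet B ∧ 0 < P B ∧ P B ≤ P A * 2⁻¹ ^ n := by
    intro n
    induction n with
    | zero => exact ⟨A, subset_rfl, hA, h0, by simp⟩
    | succ n ih =>
      obtain ⟨B, hBA, hB, hB0, hle⟩ := ih
      obtain ⟨D, hDB, hD, hD0, hDle⟩ := hP.exists_subset_le_half hB hB0
      refine ⟨D, hDB.trans hBA, hD, hD0, hDle.trans ?_⟩
      rw [pow_succ, ← mul_assoc, ENNReal.div_eq_inv_mul, mul_comm]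
      gcongr
  have hlim : Filter.Tendsto (fun n : ℕ => P A * 2⁻¹ ^ n) Filter.atTop (nhds (P A * 0)) :=
    ENNReal.Tendsto.const_mul (ENNReal.tendsto_pow_atTop_nhds_zero_of_lt_one (by simp))
      (Or.inr (measure_ne_top P A))
  rw [mul_zero] at hlim
  obtain ⟨n, hn'⟩ := (hlim.eventually_lt_const hε).exists
  obtain ⟨B, hBA, hB, hB0, hle⟩ := hn n
  exact ⟨B, hBA, hB, hB0, hle.trans_lt hn'⟩

/-- Sierpiński's theorem: a nonatomic finite measure takes all intermediate values. -/
theorem IsNonatomic.exists_subset_eq [IsFiniteMeasure P] (hP : IsNonatomic P) {A : Set S}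
    (hA : MeasurableSet A) {t : ℝ≥0∞} (ht : t ≤ P A) :
    ∃ B ⊆ A, MeasurableSet B ∧ P B = t := by
  let T := {B : Set S // B ⊆ A ∧ MeasurableSet B ∧ P B ≤ t}
  -- Greedy choice: `B'` realises at least half of the gain over `B` available to any admissible
  -- superset `C`.
  have step : ∀ B : T, ∃ B' : T, B.1 ⊆ B'.1 ∧
      ∀ C : T, B.1 ⊆ C.1 → P C.1 + P B.1 ≤ 2 * P B'.1 := by
    intro B
    by_contra! hcon
    set s := ⨆ C : {C : T // B.1 ⊆ C.1}, P C.1.1 with hs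
    have hs_top : s ≠ ∞ := by
      refine ne_top_of_le_ne_top (measure_ne_top P A) (iSup_le fun C => measure_mono C.1.2.1)
    have hle : ∀ C : T, B.1 ⊆ C.1 → P C.1 ≤ s := fun C hC =>
      le_iSup (fun C : {C : T // B.1 ⊆ C.1} => P C.1.1) ⟨C, hC⟩
    have hBs := hle B subset_rfl
    rcases hBs.eq_or_lt with heq | hlt
    · obtain ⟨C, hBC, hC⟩ := hcon B subset_rfl
      have := hle C hBC
      rw [← heq] at this
      rw [two_mul] at hC
      exact absurd (hC.trans_le (by gcongr)) (lt_irrefl _)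
    · have hmid : (s + P B.1) / 2 < s := by
        rw [ENNReal.div_lt_iff (by simp) (by simp), mul_two]
        exact ENNReal.add_lt_add_left hs_top hlt
      obtain ⟨⟨B', hBB'⟩, hB'⟩ := lt_iSup_iff.1 hmid
      obtain ⟨C, hBC, hC⟩ := hcon B' hBB'
      rw [ENNReal.div_lt_iff (by simp) (by simp), mul_comm] at hB'
      exact absurd ((hB'.trans hC).trans_le (by gcongr; exact hle C hBC)) (lt_irrefl _)
  choose next hsub hnext using step
  let B : ℕ → T := fun n => Nat.rec ⟨∅, by simp⟩ (fun _ b => next b) n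
  have hBs : ∀ n, B (n + 1) = next (B n) := fun n => rfl
  have hmono : Monotone fun n => (B n).1 := monotone_nat_of_le_succ fun n => by
    rw [hBs]; exact hsub _
  have hlim := tendsto_measure_iUnion_atTop (μ := P) hmono
  have hUA : (⋃ n, (B n).1) ⊆ A := Set.iUnion_subset fun n => (B n).2.1
  have hU : MeasurableSet (⋃ n, (B n).1) := MeasurableSet.iUnion fun n => (B n).2.2.1
  have hUt : P (⋃ n, (B n).1) ≤ t := le_of_tendsto' hlim fun n => (B n).2.2.2
  refine ⟨_, hUA, hU, hUt.eq_of_not_lt fun hlt => ?_⟩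
  have hpos : 0 < P (A \ ⋃ n, (B n).1) := by
    rw [measure_sdiff hUA hU.nullMeasurableSet (measure_ne_top P _)]
    exact tsub_pos_of_lt (hlt.trans_le ht)
  -- If mass were missing, a small non-null `D` could be added to the union. The result competes at
  -- every stage, and the greedy inequality in the limit forces `P D = 0`.
  obtain ⟨D, hDA, hD, hD0, hDt⟩ := hP.exists_subset_lt (hA.diff hU) hpos (tsub_pos_of_lt hlt)
  have hdisj : Disjoint (⋃ n, (B n).1) D :=
    (Set.disjoint_sdiff_right).mono_right hDA
  have hPC : P ((⋃ n, (B n).1) ∪ D) = P (⋃ n, (B n).1) + P D := measure_union hdisj hD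
  let C : T := ⟨(⋃ n, (B n).1) ∪ D,
    Set.union_subset hUA (hDA.trans Set.sdiff_subset), hU.union hD, by
      rw [hPC]
      exact (add_le_add_right hDt.le _).trans_eq (add_tsub_cancel_of_le hUt)⟩
  have hineq : ∀ n, P C.1 + P (B n).1 ≤ 2 * P (B (n + 1)).1 := fun n => by
    rw [hBs]
    exact hnext (B n) C ((Set.subset_iUnion (fun n => (B n).1) n).trans Set.subset_union_left)
  have h2 := le_of_tendsto_of_tendsto' (tendsto_const_nhds.add hlim)
    (ENNReal.Tendsto.const_mul ((Filter.tendsto_add_atTop_iff_nat 1).2 hlim)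
      (Or.inr (by simp))) hineq
  rw [two_mul, ENNReal.add_le_add_iff_right (measure_ne_top P _)] at h2
  change P ((⋃ n, (B n).1) ∪ D) ≤ _ at h2
  rw [hPC] at h2
  exact absurd h2 (not_le.2 (ENNReal.lt_add_right (measure_ne_top P _) hD0.ne'))

/-- A nested sequence of equipartitions of a nonatomic probability space into `2 ^ n` cells. -/
theorem IsNonatomic.exists_dyadic [IsProbabilityMeasure P] (hP : IsNonatomic P) :
    ∃ X : ℕ → S → ℕ, (∀ n, Measurable (X n)) ∧
      (∀ n s, X (n + 1) s = 2 * X n s ∨ X (n + 1) s = 2 * X n s + 1) ∧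
      (∀ n s, X n s < 2 ^ n) ∧ ∀ n, ∀ j < 2 ^ n, P (X n ⁻¹' {j}) = 2⁻¹ ^ n := by
  have hhalf : ∀ A : Set S, ∃ B ⊆ A, MeasurableSet A → MeasurableSet B ∧ P B = P A / 2 := by
    intro A
    by_cases hA : MeasurableSet A
    · obtain ⟨B, hBA, hB, hPB⟩ := hP.exists_subset_eq hA (t := P A / 2) ENNReal.half_le_self
      exact ⟨B, hBA, fun _ => ⟨hB, hPB⟩⟩
    · exact ⟨∅, by simp, fun h => absurd h hA⟩
  choose H hHA hH using hhalf
  classical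
  -- Each stage appends a binary digit: `0` on the chosen half of the current cell, `1` on the rest.
  let X : ℕ → S → ℕ := fun n => Nat.rec (fun _ => 0)
    (fun _ x s => if s ∈ H (x ⁻¹' {x s}) then 2 * x s else 2 * x s + 1) n
  have hX : ∀ n s, X (n + 1) s =
    if s ∈ H (X n ⁻¹' {X n s}) then 2 * X n s else 2 * X n s + 1 := fun n s => rfl
  have hev : ∀ n j, X (n + 1) ⁻¹' {2 * j} = H (X n ⁻¹' {j}) := by
    intro n j
    ext s
    simp only [Set.mem_preimage, Set.mem_singleton_iff, hX]
    constructor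
    · intro h
      split_ifs at h with h1
      · obtain rfl : X n s = j := by omega
        exact h1
      · omega
    · intro h
      have hj : X n s = j := hHA _ h
      rw [hj, if_pos h]
  have hod : ∀ n j, X (n + 1) ⁻¹' {2 * j + 1} = X n ⁻¹' {j} \ H (X n ⁻¹' {j}) := by
    intro n j
    ext s
    simp only [Set.mem_preimage, Set.mem_singleton_iff, hX, Set.mem_sdiff]
    constructor
    · intro h
      split_ifs at h with h1
      · omega
      · obtain rfl : X n s = j := by omega
        exact ⟨rfl, h1⟩
    · rintro ⟨hj, h⟩
      rw [hj, if_neg h]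
  have hmeas : ∀ n, Measurable (X n) := by
    intro n
    induction n with
    | zero => exact measurable_const
    | succ n ih =>
      refine measurable_to_countable' fun i => ?_
      have hj := fun j => ih (measurableSet_singleton j)
      rcases Nat.even_or_odd' i with ⟨j, rfl | rfl⟩
      · rw [hev]; exact (hH _ (hj j)).1
      · rw [hod]; exact (hj j).diff (hH _ (hj j)).1
  refine ⟨X, hmeas, fun n s => ?_, fun n s => ?_, fun n => ?_⟩
  · rw [hX]; split_ifs <;> simp
  · induction n with
    | zero => simp [X]
    | succ n ih => rw [hX, pow_succ]; split_ifs <;> omega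
  · induction n with
    | zero =>
      intro j hj
      obtain rfl : j = 0 := by simpa using hj
      have : X 0 ⁻¹' {0} = Set.univ := by ext s; simp [X]
      simp [this]
    | succ n ih =>
      intro i hi
      have hj := fun j => hmeas n (measurableSet_singleton j)
      rw [pow_succ] at hi
      rcases Nat.even_or_odd' i with ⟨j, rfl | rfl⟩
      · rw [hev, (hH _ (hj j)).2, ih j (by omega), pow_succ, div_eq_mul_inv]
      · rw [hod, measure_sdiff (hHA _) (hH _ (hj j)).1.nullMeasurableSet (measure_ne_top P _),
          (hH _ (hj j)).2, ih j (by omega), ENNReal.sub_half (by simp), pow_succ, div_eq_mul_inv]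

theorem measureReal_preimage_Iio [IsProbabilityMeasure P] {X : S → ℕ} (hX : Measurable X)
    {n : ℕ} (h : ∀ j < 2 ^ n, P (X ⁻¹' {j}) = 2⁻¹ ^ n) {m : ℕ} (hm : m ≤ 2 ^ n) :
    P.real (X ⁻¹' Set.Iio m) = m / 2 ^ n := by
  induction m with
  | zero => simp
  | succ m ih =>
    have hu : X ⁻¹' Set.Iio (m + 1) = X ⁻¹' Set.Iio m ∪ X ⁻¹' {m} := by
      ext s
      simp only [Set.mem_preimage, Set.mem_Iio, Set.mem_union, Set.mem_singleton_iff]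
      omega
    have hd : Disjoint (X ⁻¹' Set.Iio m) (X ⁻¹' {m}) :=
      Disjoint.preimage _ (by simp)
    rw [hu, measureReal_union hd (hX (measurableSet_singleton m)), ih (by omega),
      measureReal_def, h m (by omega)]
    simp only [ENNReal.toReal_pow, ENNReal.toReal_inv, ENNReal.toReal_ofNat, Nat.cast_add,
      Nat.cast_one, inv_pow]
    ring

open unitInterval in
/-- A nonatomic probability space carries a uniformly distributed random variable. -/
theorem IsNonatomic.exists_uniform [IsProbabilityMeasure P] (hP : IsNonatomic P) :
    ∃ U : S → I, Measurable U ∧ P.map U = volume := by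
  obtain ⟨X, hX, hrec, hlt, hcell⟩ := hP.exists_dyadic
  have h2 : ∀ n : ℕ, (0 : ℝ) < 2 ^ n := fun n => by positivity
  have hI : ∀ n s, (X n s : ℝ) / 2 ^ n ∈ I := fun n s =>
    ⟨by positivity, (div_le_one (h2 n)).2 (by exact_mod_cast (hlt n s).le)⟩
  have hI' : ∀ n s, ((X n s : ℝ) + 1) / 2 ^ n ∈ I := fun n s =>
    ⟨by positivity, (div_le_one (h2 n)).2 (by exact_mod_cast (hlt n s))⟩
  have hlow : ∀ s, Monotone fun n => (X n s : ℝ) / 2 ^ n := fun s =>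
    monotone_nat_of_le_succ fun n => by
      rw [div_le_div_iff₀ (h2 _) (h2 _), pow_succ]
      have : 2 * X n s ≤ X (n + 1) s := by rcases hrec n s with h | h <;> omega
      have : 2 * (X n s : ℝ) ≤ X (n + 1) s := by exact_mod_cast this
      nlinarith [h2 n]
  have hupp : ∀ s, Antitone fun n => ((X n s : ℝ) + 1) / 2 ^ n := fun s =>
    antitone_nat_of_succ_le fun n => by
      rw [div_le_div_iff₀ (h2 _) (h2 _), pow_succ]
      have : X (n + 1) s ≤ 2 * X n s + 1 := by rcases hrec n s with h | h <;> omega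
      have : (X (n + 1) s : ℝ) ≤ 2 * X n s + 1 := by exact_mod_cast this
      nlinarith [h2 n]
  -- The real number with these binary digits, squeezed between `X n / 2 ^ n` and `(X n + 1) / 2 ^
  -- n`; its distribution function is therefore known up to one cell of mass `2⁻¹ ^ n`.
  let U : S → I := fun s => ⨆ n, ⟨(X n s : ℝ) / 2 ^ n, hI n s⟩
  have hU : Measurable U := by
    refine Measurable.iSup fun n => Measurable.subtype_mk ?_
    exact ((measurable_of_countable (fun j : ℕ => (j : ℝ))).comp (hX n)).div_const _
  have hUl : ∀ n s, (X n s : ℝ) / 2 ^ n ≤ U s := fun n s =>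
    le_iSup (fun n => (⟨(X n s : ℝ) / 2 ^ n, hI n s⟩ : I)) n
  have hUu : ∀ n s, (U s : ℝ) ≤ ((X n s : ℝ) + 1) / 2 ^ n := fun n s => by
    have : U s ≤ ⟨((X n s : ℝ) + 1) / 2 ^ n, hI' n s⟩ := iSup_le fun l => by
      change (X l s : ℝ) / 2 ^ l ≤ ((X n s : ℝ) + 1) / 2 ^ n
      calc (X l s : ℝ) / 2 ^ l ≤ (X (max l n) s : ℝ) / 2 ^ (max l n) := hlow s (le_max_left _ _)
        _ ≤ ((X (max l n) s : ℝ) + 1) / 2 ^ (max l n) := by gcongr; linarith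
        _ ≤ _ := hupp s (le_max_right _ _)
    exact this
  refine ⟨U, hU, ?_⟩
  have : IsProbabilityMeasure (P.map U) := Measure.isProbabilityMeasure_map hU.aemeasurable
  refine Measure.ext_of_Iic _ _ fun x => ?_
  rw [unitInterval.volume_Iic, Measure.map_apply hU measurableSet_Iic,
    ← ofReal_measureReal (measure_ne_top P _)]
  congr 1
  have hfl : ∀ n : ℕ, ⌊(x : ℝ) * 2 ^ n⌋₊ ≤ 2 ^ n := fun n => by
    refine Nat.floor_le_of_le ?_
    push_cast
    nlinarith [h2 n, x.2.2]
  have hup : ∀ n : ℕ, P.real (U ⁻¹' Set.Iic x) ≤ x + 2⁻¹ ^ n := fun n => by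
    have hsub : U ⁻¹' Set.Iic x ⊆ X n ⁻¹' Set.Iio ⌊(x : ℝ) * 2 ^ n⌋₊ ∪
        X n ⁻¹' {⌊(x : ℝ) * 2 ^ n⌋₊} := by
      intro s hs
      have h1 : (X n s : ℝ) / 2 ^ n ≤ x := (hUl n s).trans hs
      have := Nat.le_floor ((div_le_iff₀ (h2 n)).1 h1)
      simp only [Set.mem_union, Set.mem_preimage, Set.mem_Iio, Set.mem_singleton_iff]
      omega
    have hsing : P.real (X n ⁻¹' {⌊(x : ℝ) * 2 ^ n⌋₊}) ≤ 2⁻¹ ^ n := by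
      -- The floor equals `2 ^ n` only for `x = 1`; that index lies past the last cell.
      rcases (hfl n).lt_or_eq with h | h
      · rw [measureReal_def, hcell n _ h]; simp
      · have : X n ⁻¹' {⌊(x : ℝ) * 2 ^ n⌋₊} = ∅ := by
          ext s; simp [h, (hlt n s).ne]
        rw [this]; simp
    calc _ ≤ _ := measureReal_mono hsub
      _ ≤ _ := measureReal_union_le _ _
      _ ≤ x + 2⁻¹ ^ n := by
        rw [measureReal_preimage_Iio (hX n) (hcell n) (hfl n)]
        gcongr
        rw [div_le_iff₀ (h2 n)]
        exact Nat.floor_le (mul_nonneg x.2.1 (h2 n).le)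
  have hdown : ∀ n : ℕ, (x : ℝ) - 2⁻¹ ^ n ≤ P.real (U ⁻¹' Set.Iic x) := fun n => by
    have hsub : X n ⁻¹' Set.Iio ⌊(x : ℝ) * 2 ^ n⌋₊ ⊆ U ⁻¹' Set.Iic x := by
      intro s hs
      have h1 : X n s + 1 ≤ ⌊(x : ℝ) * 2 ^ n⌋₊ := hs
      have h3 := (Nat.le_floor_iff (mul_nonneg x.2.1 (h2 n).le)).1 h1
      push_cast at h3
      exact (hUu n s).trans ((div_le_iff₀ (h2 n)).2 h3)
    refine le_trans ?_ (measureReal_mono hsub)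
    rw [measureReal_preimage_Iio (hX n) (hcell n) (hfl n), le_div_iff₀ (h2 n), sub_mul,
      ← mul_pow]
    have := Nat.lt_floor_add_one ((x : ℝ) * 2 ^ n)
    norm_num
    linarith
  have hlim : Filter.Tendsto (fun n : ℕ => (2⁻¹ : ℝ) ^ n) Filter.atTop (nhds 0) :=
    tendsto_pow_atTop_nhds_zero_of_lt_one (by norm_num) (by norm_num)
  refine le_antisymm ?_ ?_
  · refine ge_of_tendsto' (x := Filter.atTop) (f := fun n : ℕ => (x : ℝ) + 2⁻¹ ^ n) ?_ hup
    simpa using hlim.const_add (x : ℝ)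
  · refine le_of_tendsto' (x := Filter.atTop) (f := fun n : ℕ => (x : ℝ) - 2⁻¹ ^ n) ?_ hdown
    simpa using hlim.const_sub (x : ℝ)

/-- Every law on a standard Borel space is realised on a nonatomic probability space. -/
theorem IsNonatomic.exists_map_eq [IsProbabilityMeasure P] (hP : IsNonatomic P) {Y : Type*}
    [MeasurableSpace Y] [StandardBorelSpace Y] (μ : Measure Y) [IsProbabilityMeasure μ] :
    ∃ T : S → Y, Measurable T ∧ P.map T = μ := by
  obtain ⟨U, hU, hPU⟩ := hP.exists_uniform
  have : Nonempty Y := nonempty_of_isProbabilityMeasure μ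
  obtain ⟨F, hF, hFμ⟩ := μ.exists_measurable_map_eq
  exact ⟨F ∘ U, hF.comp hU, by rw [← Measure.map_map hF hU, hPU, hFμ]⟩

end

/-! ### Rotations of intervals with a prescribed two-valued increment. -/

/-- The increment over the point `t` of the rotation by `z` of the interval `[0, z - y)`, for
`q = ((y, z), t)`. -/
noncomputable def rotationStep (q : (ℝ × ℝ) × ℝ) : ℝ :=
  if q.2 < -q.1.1 then q.1.2 else q.1.1

theorem measurable_rotationStep : Measurable rotationStep :=
  Measurable.ite (measurableSet_lt measurable_snd (by fun_prop)) (by fun_prop) (by fun_prop)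

/-- The points `((y, z), t)` with `0 ≤ t < z - y`. -/
def rotationDomain : Set ((ℝ × ℝ) × ℝ) := {q | 0 ≤ q.2 ∧ q.2 < q.1.2 - q.1.1}

theorem measurableSet_rotationDomain : MeasurableSet rotationDomain :=
  (measurableSet_le measurable_const measurable_snd).inter
    (measurableSet_lt measurable_snd (by fun_prop))

/-- The pairs of a nonpositive and a positive value, under the product law. -/
noncomputable def signPairs (μ : Measure ℝ) : Measure (ℝ × ℝ) :=
  (μ.restrict (Set.Iic 0)).prod (μ.restrict (Set.Ioi 0))

/-- The law, for a centred law `μ`, under which the rotation step has law `μ` and the rotation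
preserves the law of the rotated point. -/
noncomputable def rotationLaw (μ : Measure ℝ) : Measure ((ℝ × ℝ) × ℝ) :=
  (∫⁻ x, ENNReal.ofReal x ∂μ)⁻¹ • ((signPairs μ).prod volume).restrict rotationDomain

/-- The increment is `z` on a piece of length `-y` and `y` on a piece of length `z`: these weights
make the two-point law centred. -/
theorem volume_slice_rotationStep {y z : ℝ} (hy : y ≤ 0) (hz : 0 < z) (A : Set ℝ) :
    volume (Prod.mk (y, z) ⁻¹' (rotationStep ⁻¹' A ∩ rotationDomain)) =
      ENNReal.ofReal (-y) * A.indicator 1 z + A.indicator 1 y * ENNReal.ofReal z := by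
  have h : Prod.mk (y, z) ⁻¹' (rotationStep ⁻¹' A ∩ rotationDomain) =
      (Set.Ico 0 (-y) ∩ {_t | z ∈ A}) ∪ (Set.Ico (-y) (z - y) ∩ {_t | y ∈ A}) := by
    ext t
    simp only [rotationStep, rotationDomain, Set.mem_preimage, Set.mem_inter_iff,
      Set.mem_ofPred_eq, Set.mem_union, Set.mem_Ico]
    split_ifs with ht
    · constructor
      · rintro ⟨h1, h2, h3⟩; exact Or.inl ⟨⟨h2, ht⟩, h1⟩
      · rintro (⟨⟨h1, h2⟩, h3⟩ | ⟨⟨h1, h2⟩, h3⟩)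
        · exact ⟨h3, h1, by linarith⟩
        · linarith
    · constructor
      · rintro ⟨h1, h2, h3⟩; exact Or.inr ⟨⟨not_lt.1 ht, h3⟩, h1⟩
      · rintro (⟨⟨h1, h2⟩, h3⟩ | ⟨⟨h1, h2⟩, h3⟩)
        · exact absurd h2 ht
        · exact ⟨h3, by linarith, h2⟩
  have hd : Disjoint (Set.Ico 0 (-y) ∩ {_t | z ∈ A}) (Set.Ico (-y) (z - y) ∩ {_t | y ∈ A}) :=
    (Set.Ico_disjoint_Ico_same (a := 0) (b := -y) (c := z - y)).mono Set.inter_subset_left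
      Set.inter_subset_left
  rw [h, measure_union hd (measurableSet_Ico.inter (MeasurableSet.const _))]
  congr 1
  · by_cases hA : z ∈ A <;> simp [hA]
  · by_cases hA : y ∈ A <;> simp [hA]

/-- The rotation exchanges two intervals: `[0, -y)` moves by `z` onto `[z, z - y)`, and `[-y, z -
y)` moves by `y` onto `[0, z)`. The images tile the domain, and translations preserve Lebesgue
measure. -/
theorem volume_slice_rotation {y z : ℝ} (hy : y ≤ 0) (hz : 0 < z) {A : Set ℝ}
    (hA : MeasurableSet A) :
    volume (Prod.mk (y, z) ⁻¹' ((fun q => q.2 + rotationStep q) ⁻¹' A ∩ rotationDomain)) =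
      volume (Prod.mk (y, z) ⁻¹' (Prod.snd ⁻¹' A ∩ rotationDomain)) := by
  have h : Prod.mk (y, z) ⁻¹' ((fun q => q.2 + rotationStep q) ⁻¹' A ∩ rotationDomain) =
      ((· + z) ⁻¹' (A ∩ Set.Ico z (z - y))) ∪ ((· + y) ⁻¹' (A ∩ Set.Ico 0 z)) := by
    ext t
    simp only [rotationStep, rotationDomain, Set.mem_preimage, Set.mem_inter_iff,
      Set.mem_ofPred_eq, Set.mem_union, Set.mem_Ico]
    split_ifs with ht
    · constructor
      · rintro ⟨h1, h2, h3⟩; exact Or.inl ⟨h1, by linarith, by linarith⟩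
      · rintro (⟨h1, h2, h3⟩ | ⟨h1, h2, h3⟩)
        · exact ⟨h1, by linarith, by linarith⟩
        · linarith
    · constructor
      · rintro ⟨h1, h2, h3⟩; exact Or.inr ⟨h1, by linarith, by linarith⟩
      · rintro (⟨h1, h2, h3⟩ | ⟨h1, h2, h3⟩)
        · exact absurd (by linarith) ht
        · exact ⟨h1, by linarith, by linarith⟩
  have h' : Prod.mk (y, z) ⁻¹' (Prod.snd ⁻¹' A ∩ rotationDomain) =
      (A ∩ Set.Ico z (z - y)) ∪ (A ∩ Set.Ico 0 z) := by
    ext t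
    simp only [rotationDomain, Set.mem_preimage, Set.mem_inter_iff,
      Set.mem_ofPred_eq, Set.mem_union, Set.mem_Ico]
    constructor
    · rintro ⟨h1, h2, h3⟩
      rcases lt_or_ge t z with h4 | h4
      · exact Or.inr ⟨h1, h2, h4⟩
      · exact Or.inl ⟨h1, h4, h3⟩
    · rintro (⟨h1, h2, h3⟩ | ⟨h1, h2, h3⟩)
      · exact ⟨h1, by linarith, h3⟩
      · exact ⟨h1, h2, by linarith⟩
  have hd : Disjoint ((· + z) ⁻¹' (A ∩ Set.Ico z (z - y))) ((· + y) ⁻¹' (A ∩ Set.Ico 0 z)) := by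
    rw [Set.disjoint_left]
    rintro t ⟨-, h1, h2⟩ ⟨-, h3, h4⟩
    simp only at h1 h2 h3 h4
    linarith
  have hd' : Disjoint (A ∩ Set.Ico z (z - y)) (A ∩ Set.Ico 0 z) := by
    rw [Set.disjoint_left]
    rintro t ⟨-, h1, h2⟩ ⟨-, h3, h4⟩
    linarith
  have hA2 : MeasurableSet (A ∩ Set.Ico 0 z) := hA.inter measurableSet_Ico
  rw [h, h', measure_union hd (hA2.preimage (measurable_add_const y)), measure_union hd' hA2,
    measure_preimage_add_right, measure_preimage_add_right]

/-! ### The mixed rotation law and its moments. -/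

section

variable {μ : Measure ℝ}

theorem ae_signPairs [SFinite μ] : ∀ᵐ p ∂signPairs μ, p.1 ≤ 0 ∧ 0 < p.2 := by
  have h1 : ∀ᵐ y ∂μ.restrict (Set.Iic 0), y ≤ 0 := ae_restrict_mem measurableSet_Iic
  have h2 : ∀ᵐ z ∂μ.restrict (Set.Ioi 0), 0 < z := ae_restrict_mem measurableSet_Ioi
  exact (Measure.quasiMeasurePreserving_fst.ae h1).and (Measure.quasiMeasurePreserving_snd.ae h2)

theorem rotationLaw_apply [SFinite μ] {E : Set ((ℝ × ℝ) × ℝ)} (hE : MeasurableSet E) :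
    rotationLaw μ E = (∫⁻ x, ENNReal.ofReal x ∂μ)⁻¹ *
      ∫⁻ p, volume (Prod.mk p ⁻¹' (E ∩ rotationDomain)) ∂signPairs μ := by
  have : SFinite (signPairs μ) := by unfold signPairs; infer_instance
  rw [rotationLaw, Measure.smul_apply, Measure.restrict_apply hE,
    Measure.prod_apply (hE.inter measurableSet_rotationDomain), smul_eq_mul]

theorem map_rotation_rotationLaw [SFinite μ] :
    (rotationLaw μ).map (fun q => q.2 + rotationStep q) = (rotationLaw μ).map Prod.snd := by
  have hm : Measurable fun q : (ℝ × ℝ) × ℝ => q.2 + rotationStep q :=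
    measurable_snd.add measurable_rotationStep
  ext A hA
  rw [Measure.map_apply hm hA, Measure.map_apply measurable_snd hA, rotationLaw_apply (hm hA),
    rotationLaw_apply (measurable_snd hA)]
  congr 1
  refine lintegral_congr_ae ?_
  filter_upwards [ae_signPairs] with p hp
  exact volume_slice_rotation hp.1 hp.2 hA

theorem setLIntegral_Ioi_ofReal :
    ∫⁻ x in Set.Ioi 0, ENNReal.ofReal x ∂μ = ∫⁻ x, ENNReal.ofReal x ∂μ := by
  rw [← lintegral_indicator measurableSet_Ioi]
  refine lintegral_congr fun x => ?_
  by_cases hx : x ∈ Set.Ioi (0 : ℝ)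
  · rw [Set.indicator_of_mem hx]
  · rw [Set.indicator_of_notMem hx, ENNReal.ofReal_of_nonpos (not_lt.1 hx)]

theorem setLIntegral_Iic_ofReal_neg :
    ∫⁻ x in Set.Iic 0, ENNReal.ofReal (-x) ∂μ = ∫⁻ x, ENNReal.ofReal (-x) ∂μ := by
  rw [← lintegral_indicator measurableSet_Iic]
  refine lintegral_congr fun x => ?_
  by_cases hx : x ∈ Set.Iic (0 : ℝ)
  · rw [Set.indicator_of_mem hx]
  · rw [Set.indicator_of_notMem hx, ENNReal.ofReal_of_nonpos]
    simp only [Set.mem_Iic, not_le] at hx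
    linarith

theorem lintegral_ofReal_ne_top (hi : Integrable (fun x : ℝ => x) μ) :
    ∫⁻ x, ENNReal.ofReal x ∂μ ≠ ∞ :=
  (hi.lintegral_lt_top).ne

theorem lintegral_ofReal_neg_eq (hi : Integrable (fun x : ℝ => x) μ) (h0 : ∫ x, x ∂μ = 0) :
    ∫⁻ x, ENNReal.ofReal (-x) ∂μ = ∫⁻ x, ENNReal.ofReal x ∂μ := by
  rw [integral_eq_lintegral_pos_part_sub_lintegral_neg_part hi, sub_eq_zero] at h0
  exact ((ENNReal.toReal_eq_toReal_iff' (lintegral_ofReal_ne_top hi)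
    (hi.neg.lintegral_lt_top).ne).1 h0).symm

/-- The product integral factorises. Centring makes the positive and negative parts have the same
integral, which cancels the normalising constant and leaves `μ` of the two halves of `A`. -/
theorem map_rotationStep_rotationLaw [SFinite μ] (hi : Integrable (fun x : ℝ => x) μ)
    (h0 : ∫ x, x ∂μ = 0) (hc : ∫⁻ x, ENNReal.ofReal x ∂μ ≠ 0) :
    (rotationLaw μ).map rotationStep = μ := by
  ext A hA
  rw [Measure.map_apply measurable_rotationStep hA, rotationLaw_apply (measurable_rotationStep hA)]
  have h1 : ∫⁻ p, volume (Prod.mk p ⁻¹' (rotationStep ⁻¹' A ∩ rotationDomain)) ∂signPairs μ =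
      ∫⁻ p, (ENNReal.ofReal (-p.1) * A.indicator 1 p.2 + A.indicator 1 p.1 * ENNReal.ofReal p.2)
        ∂signPairs μ := by
    refine lintegral_congr_ae ?_
    filter_upwards [ae_signPairs] with p hp
    exact volume_slice_rotationStep hp.1 hp.2 A
  have hind : Measurable (A.indicator (1 : ℝ → ℝ≥0∞)) := measurable_one.indicator hA
  have h2 : ∀ B : Set ℝ, ∫⁻ x in B, A.indicator 1 x ∂μ = μ (A ∩ B) := fun B => by
    rw [lintegral_indicator_one hA, Measure.restrict_apply hA]
  rw [h1, lintegral_add_left (by fun_prop), signPairs,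
    lintegral_prod_mul (f := fun y => ENNReal.ofReal (-y)) (by fun_prop) hind.aemeasurable,
    lintegral_prod_mul (g := fun z => ENNReal.ofReal z) hind.aemeasurable (by fun_prop),
    setLIntegral_Ioi_ofReal, setLIntegral_Iic_ofReal_neg, lintegral_ofReal_neg_eq hi h0, h2, h2,
    mul_comm (μ _), ← mul_add, ← mul_assoc, ENNReal.inv_mul_cancel hc (lintegral_ofReal_ne_top hi),
    one_mul, add_comm, ← Set.compl_Iic, ← Set.sdiff_eq,
    measure_inter_add_sdiff A measurableSet_Iic]

theorem memLp_sub_signPairs [IsFiniteMeasure μ] {p : ℝ≥0∞} (h : MemLp (fun x : ℝ => x) p μ) :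
    MemLp (fun q : ℝ × ℝ => q.2 - q.1) p (signPairs μ) :=
  ((h.restrict _).comp_snd _).sub ((h.restrict _).comp_fst _)

theorem memLp_top_snd_rotationLaw [IsFiniteMeasure μ] (h : MemLp (fun x : ℝ => x) ∞ μ) :
    MemLp Prod.snd ∞ (rotationLaw μ) := by
  have : SFinite (signPairs μ) := by unfold signPairs; infer_instance
  have h1 := memLp_sub_signPairs h
  have h2 : ∀ᵐ q ∂signPairs μ, ‖q.2 - q.1‖ ≤ (eLpNormEssSup (fun q : ℝ × ℝ => q.2 - q.1)
      (signPairs μ)).toReal := by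
    filter_upwards [enorm_ae_le_eLpNormEssSup (fun q : ℝ × ℝ => q.2 - q.1) (signPairs μ)] with q hq
    have h3 : eLpNormEssSup (fun q : ℝ × ℝ => q.2 - q.1) (signPairs μ) ≠ ∞ := by
      rw [← eLpNorm_exponent_top]; exact h1.2.ne
    rw [← toReal_enorm]
    exact ENNReal.toReal_mono h3 hq
  have h3 := Measure.quasiMeasurePreserving_fst (μ := signPairs μ) (ν := (volume : Measure ℝ)).ae h2
  refine memLp_top_of_bound measurable_snd.aestronglyMeasurable
    (eLpNormEssSup (fun q : ℝ × ℝ => q.2 - q.1) (signPairs μ)).toReal ?_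
  refine Measure.ae_smul_measure ?_ _
  filter_upwards [ae_restrict_of_ae h3, ae_restrict_mem measurableSet_rotationDomain] with q hq hD
  refine le_trans ?_ hq
  rw [Real.norm_of_nonneg hD.1]
  exact hD.2.le.trans (Real.le_norm_self _)

/-- A slice has length `z - y` and its points are below `z - y`, so the `n`-th moment of the point
is controlled by moment `n + 1` of `z - y`. The lost moment is harmless when all moments are finite.
-/
theorem memLp_snd_rotationLaw [IsFiniteMeasure μ] (hc : ∫⁻ x, ENNReal.ofReal x ∂μ ≠ 0)
    (h : ∀ n : ℕ, MemLp (fun x : ℝ => x) n μ) (n : ℕ) :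
    MemLp Prod.snd n (rotationLaw μ) := by
  have : SFinite (signPairs μ) := by unfold signPairs; infer_instance
  rcases Nat.eq_zero_or_pos n with rfl | hn
  · simpa using measurable_snd.aestronglyMeasurable
  have h1 := memLp_sub_signPairs (h (n + 1))
  have h2 := h1.2
  rw [eLpNorm_lt_top_iff_lintegral_rpow_enorm_lt_top (by simp) (by simp)] at h2
  refine ⟨measurable_snd.aestronglyMeasurable, ?_⟩
  rw [eLpNorm_lt_top_iff_lintegral_rpow_enorm_lt_top (by simp; omega) (by simp)]
  simp only [ENNReal.toReal_natCast, ENNReal.rpow_natCast] at h2 ⊢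
  rw [rotationLaw, lintegral_smul_measure, smul_eq_mul]
  refine ENNReal.mul_lt_top (ENNReal.inv_lt_top.2 (pos_iff_ne_zero.2 hc)) (lt_of_le_of_lt ?_ h2)
  have hD := measurableSet_rotationDomain
  calc ∫⁻ q in rotationDomain, ‖q.2‖ₑ ^ n ∂(signPairs μ).prod volume
      ≤ ∫⁻ q in rotationDomain, ‖q.1.2 - q.1.1‖ₑ ^ n ∂(signPairs μ).prod volume := by
        refine setLIntegral_mono' hD fun q hq => ?_
        gcongr
        rw [enorm_le_iff_norm_le, Real.norm_of_nonneg hq.1]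
        exact hq.2.le.trans (Real.le_norm_self _)
    _ = ∫⁻ p, (∫⁻ t : ℝ, rotationDomain.indicator (fun q => ‖q.1.2 - q.1.1‖ₑ ^ n) (p, t))
          ∂signPairs μ := by
        rw [← lintegral_indicator hD, lintegral_prod _ (by
          refine (Measurable.indicator ?_ hD).aemeasurable
          fun_prop)]
    _ ≤ ∫⁻ p, ‖p.2 - p.1‖ₑ ^ (n + 1) ∂signPairs μ := by
        refine lintegral_mono fun p => ?_
        have h3 : ∀ t, rotationDomain.indicator (fun q => ‖q.1.2 - q.1.1‖ₑ ^ n) (p, t) =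
            (Set.Ico 0 (p.2 - p.1)).indicator (fun _ => ‖p.2 - p.1‖ₑ ^ n) t := fun t => rfl
        simp only [h3]
        rw [lintegral_indicator_const measurableSet_Ico, Real.volume_Ico, sub_zero, pow_succ]
        gcongr
        rw [← ofReal_norm]
        exact ENNReal.ofReal_le_ofReal (Real.le_norm_self _)

end

theorem IsNonatomic.isDifferenceInLaw {S : Type*} [MeasurableSpace S] {P : Measure S}
    [IsProbabilityMeasure P] (hP : IsNonatomic P) {k : PayoffClass} (f : Payoffs P k) :
    IsDifferenceInLaw f := by
  have hf := measurable_payoff f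
  let X : S → ℝ := fun s => (f : S → ℝ) s - expectation f
  have hX : Measurable X := hf.sub_const _
  have hXi : Integrable X P := (integrable_payoff f).sub (integrable_const _)
  have hX0 : ∫ s, X s ∂P = 0 := by
    rw [integral_sub (integrable_payoff f) (integrable_const _)]
    simp [expectation]
  set μ := P.map X
  have : IsProbabilityMeasure μ := Measure.isProbabilityMeasure_map hX.aemeasurable
  have hmem : ∀ p, MemLp X p P → MemLp (fun x : ℝ => x) p μ := fun p hp =>
    (memLp_map_measure_iff measurable_id.aestronglyMeasurable hX.aemeasurable).2 hp
  have hi : Integrable (fun x : ℝ => x) μ :=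
    (integrable_map_measure measurable_id.aestronglyMeasurable hX.aemeasurable).2 hXi
  have h0 : ∫ x, x ∂μ = 0 := by
    exact (integral_map hX.aemeasurable measurable_id.aestronglyMeasurable).trans hX0
  -- The normalising constant vanishes only if the centred payoff is almost surely zero; then `g = h
  -- = 0` works.
  by_cases hc : ∫⁻ x, ENNReal.ofReal x ∂μ = 0
  · have hc' := lintegral_ofReal_neg_eq hi h0
    rw [hc, lintegral_eq_zero_iff (by fun_prop)] at hc'
    rw [lintegral_eq_zero_iff (by fun_prop)] at hc
    have hz : ∀ᵐ x ∂μ, x = 0 := by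
      filter_upwards [hc, hc'] with x h1 h2
      simp only [Pi.zero_apply, ENNReal.ofReal_eq_zero] at h1 h2
      linarith
    have hz' : X =ᵐ[P] 0 := ae_of_ae_map hX.aemeasurable hz
    exact ⟨0, 0, rfl, (Measure.map_congr (hz'.trans (by simp))).symm⟩
  · have hstep := map_rotationStep_rotationLaw hi h0 hc
    have : IsProbabilityMeasure (rotationLaw μ) := by
      refine ⟨?_⟩
      have h1 : (rotationLaw μ).map rotationStep Set.univ = 1 := by rw [hstep]; exact measure_univ
      rwa [Measure.map_apply measurable_rotationStep MeasurableSet.univ] at h1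
    obtain ⟨T, hT, hPT⟩ := hP.exists_map_eq (rotationLaw μ)
    have hm : Measurable fun q : (ℝ × ℝ) × ℝ => q.2 + rotationStep q :=
      measurable_snd.add measurable_rotationStep
    have hlaw : ∀ F : (ℝ × ℝ) × ℝ → ℝ, Measurable F → P.map (F ∘ T) = (rotationLaw μ).map F :=
      fun F hF => by rw [← hPT, Measure.map_map hF hT]
    have hlp : ∀ (F : (ℝ × ℝ) × ℝ → ℝ) (p : ℝ≥0∞), Measurable F →
        (rotationLaw μ).map F = (rotationLaw μ).map Prod.snd →
        MemLp Prod.snd p (rotationLaw μ) → MemLp (F ∘ T) p P := fun F p hF hFs hp => by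
      refine (memLp_map_measure_iff (g := fun x : ℝ => x) measurable_id.aestronglyMeasurable
        (hF.comp hT).aemeasurable).1 ?_
      rw [hlaw F hF, hFs]
      exact (memLp_map_measure_iff measurable_id.aestronglyMeasurable
        measurable_snd.aemeasurable).2 hp
    -- Membership depends only on the law, so the moment bounds for the point before rotation also
    -- cover the rotated point.
    have hpay : ∀ F : (ℝ × ℝ) × ℝ → ℝ, Measurable F →
        (rotationLaw μ).map F = (rotationLaw μ).map Prod.snd → F ∘ T ∈ Payoffs P k := by
      intro F hF hFs
      cases k with
      | bounded =>
        exact ⟨hF.comp hT, hlp F _ hF hFs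
          (memLp_top_snd_rotationLaw (hmem _ (f.2.2.sub (memLp_const _))))⟩
      | finiteMoments =>
        exact ⟨hF.comp hT, fun p => hlp F _ hF hFs
          (memLp_snd_rotationLaw hc (fun n => hmem _ ((f.2.2 n).sub (memLp_const _))) p)⟩
    refine ⟨⟨_, hpay _ measurable_snd rfl⟩, ⟨_, hpay _ hm map_rotation_rotationLaw⟩, ?_, ?_⟩
    · change P.map (Prod.snd ∘ T) =
        P.map ((fun q : (ℝ × ℝ) × ℝ => q.2 + rotationStep q) ∘ T)
      rw [hlaw _ measurable_snd, hlaw _ hm, map_rotation_rotationLaw]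
    · have hd : (((fun q : (ℝ × ℝ) × ℝ => q.2 + rotationStep q) ∘ T) - (Prod.snd ∘ T) : S → ℝ) =
          rotationStep ∘ T := by
        ext s; simp
      change P.map (((fun q : (ℝ × ℝ) × ℝ => q.2 + rotationStep q) ∘ T) - (Prod.snd ∘ T)) = μ
      rw [hd, hlaw _ measurable_rotationStep, hstep]

end RiskPref

theorem mainTheorem1 {S : Type*} [MeasurableSpace S] (P : Measure S) [IsProbabilityMeasure P]
    (hP : RiskPref.IsAdequate P) (k : RiskPref.PayoffClass)
    (R : RiskPref.Payoffs P k → RiskPref.Payoffs P k → Prop)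
    (hR : RiskPref.IsRiskPreference R) :
    RiskPref.WeaklyRiskAverse R ↔ RiskPref.PropenseToFullInsurance R :=
  ⟨fun h => h.propenseToFullInsurance, fun h => h.weaklyRiskAverse hR fun f =>
    hP.elim (fun h => h.isDifferenceInLaw f) fun h => h.isDifferenceInLaw f⟩
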